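/- **Model.** Consider a synchronous network whose nodes have distinct identifiers in $\{1,\dots,n\}$. In round $i=0,1,2,\dots$ it is a simple graph $G_i=(V_i,E_i)$ with $V_i\subseteq\{1,\dots,n\}$ and $V_i\subseteq V_{i+1}$. Between consecutive rounds arbitrarily many edges may be inserted or deleted and arbitrarily many nodes may be inserted, each with an arbitrary set of incident edges; nodes are not deleted. Every node stores a label (its color) and a private memory. In each round a node knows $n$, its identifier, the round number modulo $15n$ and its current set of neighbors in $G_i$ (so it learns of topology changes only after they happen); it sends a message to each of its current neighbors, receives their messages, and updates its color and memory deterministically. An inserted node starts in a state prescribed by the algorithm. The star of $v\in V_i$ is *consistent* (for $(degree+1)$-coloring) if the color of $v$ lies in $\{1,\dots,\deg_{G_i}(v)+1\}$ and differs from the colors of all its neighbors in $G_i$. Let $\mathrm{incorrect}(i)$ be the number of rounds $t\le i$ such that some star of $G_t$ is inconsistent at the beginning of round $t$ (right after the topology changes) or at its end. Let $\mathrm{changes}(i)$ be the number of topology changes until round $i$, i.e. in the passages from $G_{t-1}$ to $G_t$ for $1\le t\le i$, where every insertion or deletion of an edge between two already present nodes counts as one change, and the insertion of a node together with all its incident edges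 counts as one change. **Corollary.** There are a deterministic distributed algorithm in this model (one for each $n$) and constants $b,k$ independent of $n$ such that for every $n$, every sequence $(G_i)_{i\ge 0}$ as above and every initial coloring for which all stars of $G_0$ are consistent (for example, an edgeless $G_0$ with all nodes colored $1$), the following hold in the execution: 1. every message sent has at most $b\lfloor\log_2 n\rfloor$ bits; 2. every star gets fixed: for every round $i$ and every $v\in V_i$ there is a round $j\ge i$ such that the star of $v$ is consistent at the end of round $j$ or the neighborhood of $v$ changes between rounds $j$ and $j+1$; 3. the amortized round complexity is at most $k$: $\mathrm{incorrect}(i)\le k\cdot\mathrm{changes}(i)$ for every round $i$. That is, there is a deterministic dynamic distributed fixing algorithm for $(degree+1)$-coloring that handles edge insertions/deletions and node insertions in $O(1)$ amortized rounds with $O(\log n)$-bit messages. -/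

import Mathlib

/-- A dynamic network whose nodes carry identifiers in `Fin n` (so `n` bounds the number of nodes).
`node i` and `graph i` are the node set and the edges during round `i`; round `0` shows the initial
graph. Arbitrarily many edges may appear or disappear and arbitrarily many nodes may be inserted
between consecutive rounds; nodes are never deleted. -/
structure DynamicNetwork (n : ℕ) where
  node : ℕ → Set (Fin n)
  graph : ℕ → SimpleGraph (Fin n)
  mem_node_of_adj : ∀ (i : ℕ) (u v : Fin n), (graph i).Adj u v → u ∈ node i
  node_subset_succ : ∀ i : ℕ, node i ⊆ node (i + 1)

namespace DynamicNetwork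

variable {n : ℕ} (D : DynamicNetwork n)

/-- The nodes inserted at the beginning of round `i + 1`. -/
def insertedNodes (i : ℕ) : Set (Fin n) := D.node (i + 1) \ D.node i

/-- The edges inserted or deleted at the beginning of round `i + 1`. Edges at a node inserted at
that moment are part of the insertion of the node, hence are not listed here. -/
def changedEdges (i : ℕ) : Set (Sym2 (Fin n)) :=
  {e | ((e ∈ (D.graph i).edgeSet ∧ e ∉ (D.graph (i + 1)).edgeSet) ∨
        (e ∈ (D.graph (i + 1)).edgeSet ∧ e ∉ (D.graph i).edgeSet)) ∧
      ∀ v ∈ e, v ∈ D.node i}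

/-- The number of topology changes until round `i`. The insertion of a node together with all of
its edges is a single change. -/
noncomputable def changes (i : ℕ) : ℕ :=
  ∑ t ∈ Finset.range i, ((D.insertedNodes t).ncard + (D.changedEdges t).ncard)

end DynamicNetwork

/-- What a node stores: its label (a color) and a private memory. -/
structure NodeState (M : Type) where
  color : ℕ
  memory : M

/-- A deterministic synchronous message-passing algorithm for nodes that know `n`. At each of its
steps a node knows its identifier, the clock (the round number modulo `15 * n`), the set of its
current neighbors and its own state; it learns about topology changes only a posteriori, from the
current neighbor set. Messages are bit strings. -/
structure DynamicAlgorithm (n : ℕ) where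
  Memory : Type
  /-- initial memory of a node present in round `0` -/
  initMemory : Fin n → Memory
  /-- state in which an inserted node enters the network -/
  newState : Fin n → NodeState Memory
  /-- `send v clock N s u`: the message that `v` sends to its neighbor `u` -/
  send : Fin n → ℕ → Set (Fin n) → NodeState Memory → Fin n → List Bool
  /-- `update v clock N s inbox`: the state of `v` at the end of the round, where `inbox u` is the
  message received from `u` if `u` is currently a neighbor, and `none` otherwise -/
  update : Fin n → ℕ → Set (Fin n) → NodeState Memory → (Fin n → Option (List Bool)) →
    NodeState Memory

namespace DynamicAlgorithm

variable {n : ℕ} (A : DynamicAlgorithm n) (D : DynamicNetwork n)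

/-- The message that `v` sends to `u` in round `i`, if `s` gives the states at the beginning
of the round. -/
def message (i : ℕ) (s : Fin n → NodeState A.Memory) (v u : Fin n) : List Bool :=
  A.send v (i % (15 * n)) ((D.graph i).neighborSet v) (s v) u

open Classical in
/-- The states at the end of round `i`, if `s` gives the states at its beginning. -/
noncomputable def round (i : ℕ) (s : Fin n → NodeState A.Memory) (v : Fin n) :
    NodeState A.Memory :=
  A.update v (i % (15 * n)) ((D.graph i).neighborSet v) (s v)
    (fun u => if (D.graph i).Adj v u then some (A.message D i s u v) else none)

open Classical in
/-- The states at the beginning of round `i` (after the topology changes of the round, before any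
computation) when the initial coloring is `c`. The values at identifiers that are not (yet) nodes
of the network have no meaning and no effect. -/
noncomputable def start (c : Fin n → ℕ) : ℕ → Fin n → NodeState A.Memory
  | 0, v => ⟨c v, A.initMemory v⟩
  | i + 1, v => if v ∈ D.node i then A.round D i (start c i) v else A.newState v

/-- The colors at the beginning of round `i`. -/
noncomputable def startColor (c : Fin n → ℕ) (i : ℕ) (v : Fin n) : ℕ :=
  (A.start D c i v).color

/-- The colors at the end of round `i`. -/
noncomputable def endColor (c : Fin n → ℕ) (i : ℕ) (v : Fin n) : ℕ :=
  (A.round D i (A.start D c i) v).color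

end DynamicAlgorithm

/-- The labeled star centered at `v` is consistent for `(degree+1)`-coloring: the color of `v` is in
`{1, …, deg v + 1}` and differs from the colors of all neighbors of `v`. -/
def StarConsistent {n : ℕ} (G : SimpleGraph (Fin n)) (col : Fin n → ℕ) (v : Fin n) : Prop :=
  1 ≤ col v ∧ col v ≤ (G.neighborSet v).ncard + 1 ∧ ∀ u, G.Adj v u → col u ≠ col v

/-- A proper `(degree+1)`-coloring of the graph `G` with node set `V`. -/
def IsDegPlusOneColoring {n : ℕ} (V : Set (Fin n)) (G : SimpleGraph (Fin n))
    (col : Fin n → ℕ) : Prop :=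
  ∀ v ∈ V, StarConsistent G col v

namespace DynamicAlgorithm

variable {n : ℕ} (A : DynamicAlgorithm n) (D : DynamicNetwork n)

/-- In round `i` there is an inconsistent star, at the beginning of the round (right after its
topology changes) or at its end. -/
def IncorrectRound (c : Fin n → ℕ) (i : ℕ) : Prop :=
  ¬ IsDegPlusOneColoring (D.node i) (D.graph i) (A.startColor D c i) ∨
  ¬ IsDegPlusOneColoring (D.node i) (D.graph i) (A.endColor D c i)

/-- The number of rounds until round `i` (inclusive) with an inconsistent star. -/
noncomputable def incorrect (c : Fin n → ℕ) (i : ℕ) : ℕ :=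
  {t : ℕ | t ≤ i ∧ A.IncorrectRound D c t}.ncard

/-- Every star gets fixed: for every round `i` and every node `v` of that round, in some round
`j ≥ i` the star of `v` is consistent at the end of the round or it is hit by a further
topology change right after that round. -/
def FixesStars (c : Fin n → ℕ) : Prop :=
  ∀ i : ℕ, ∀ v ∈ D.node i, ∃ j ≥ i,
    StarConsistent (D.graph j) (A.endColor D c j) v ∨
    (D.graph (j + 1)).neighborSet v ≠ (D.graph j).neighborSet v

/-- All messages sent in the execution have at most `b` bits. -/
def MessagesAtMost (c : Fin n → ℕ) (b : ℕ) : Prop :=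
  ∀ (i : ℕ) (v u : Fin n), (D.graph i).Adj v u →
    (A.message D i (A.start D c i) v u).length ≤ b

/-- The amortized number of incorrect rounds per topology change is at most `k` at all times. -/
def AmortizedRoundsAtMost (c : Fin n → ℕ) (k : ℕ) : Prop :=
  ∀ i : ℕ, A.incorrect D c i ≤ k * D.changes i

end DynamicAlgorithm

/-! Color `0` means "uncolored". In each round an inconsistent node gives up its color or, if it is
uncolored and locally first, takes a free color. Injective ranks keep neighbors from choosing
together, so a consistent star stays consistent while the graph is fixed. Amortization uses a
potential: a star counts 0 if consistent, 1 if inconsistent with center `0`, and 2 otherwise. Every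
incorrect round lowers the total (`potential_recolor_lt`), while a topology change raises it by at
most 4 (`potential_succ_le`). It starts at 0, so `k = 4`. Individual stars get fixed because the
rank rotates with the clock: each node periodically precedes all others. -/

section Recolor

variable {n : ℕ}

/-- The priority of a node at time `t`: its identifier, except that the node `t % n` comes first. -/
def clockRank (t : ℕ) (v : Fin n) : ℕ := if v.val = t % n then n else v.val

lemma clockRank_injective (t : ℕ) : Function.Injective (clockRank t : Fin n → ℕ) := by
  intro u v h
  have := u.isLt
  have := v.isLt
  unfold clockRank at h
  ext
  split_ifs at h <;> omega

lemma clockRank_le (t : ℕ) (v : Fin n) : clockRank t v ≤ n := by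
  have := v.isLt
  unfold clockRank
  split_ifs <;> omega

/-- This is why a clock modulo a multiple of `n` suffices. -/
lemma clockRank_mod_mul (t m : ℕ) (v : Fin n) : clockRank (t % (m * n)) v = clockRank t v := by
  unfold clockRank
  rw [Nat.mod_mul_left_mod]

/-! ### One recoloring round on a fixed graph -/

/-- The least positive color that does not occur in the neighborhood of `v`. -/
noncomputable def freeColor (G : SimpleGraph (Fin n)) (col : Fin n → ℕ) (v : Fin n) : ℕ :=
  sInf {x | 1 ≤ x ∧ ∀ u, G.Adj v u → col u ≠ x}

open Classical in
/-- One round of recoloring: a consistent star keeps its color, a node with color `0` whose clockRank is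
maximal among its neighbors with color `0` takes a free color, all other nodes get color `0`. -/
noncomputable def recolor (G : SimpleGraph (Fin n)) (p col : Fin n → ℕ) (v : Fin n) : ℕ :=
  if StarConsistent G col v then col v
  else if col v = 0 ∧ ∀ u, G.Adj v u → col u = 0 → p u ≤ p v then freeColor G col v
  else 0

variable {G : SimpleGraph (Fin n)} {p col : Fin n → ℕ} {u v : Fin n}

/-- Pigeonhole: the neighbors cannot use up `deg v + 1` colors. -/
lemma exists_freeColor (G : SimpleGraph (Fin n)) (col : Fin n → ℕ) (v : Fin n) :
    ∃ x, (1 ≤ x ∧ ∀ u, G.Adj v u → col u ≠ x) ∧ x ≤ (G.neighborSet v).ncard + 1 := by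
  by_contra! h
  have hsub : (Finset.Icc 1 ((G.neighborSet v).ncard + 1) : Set ℕ) ⊆ col '' G.neighborSet v := by
    intro x hx
    rw [Finset.coe_Icc, Set.mem_Icc] at hx
    by_contra hne
    refine absurd (h x ⟨hx.1, fun u hu hux => hne ⟨u, hu, hux⟩⟩) (by omega)
  have h1 := Set.ncard_le_ncard hsub (Set.toFinite _)
  have h2 := Set.ncard_image_le (f := col) (Set.toFinite (G.neighborSet v))
  rw [Set.ncard_coe_finset, Nat.card_Icc] at h1
  omega

lemma freeColor_spec (G : SimpleGraph (Fin n)) (col : Fin n → ℕ) (v : Fin n) :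
    1 ≤ freeColor G col v ∧ ∀ u, G.Adj v u → col u ≠ freeColor G col v := by
  obtain ⟨x, hx, -⟩ := exists_freeColor G col v
  exact Nat.sInf_mem (s := {x | 1 ≤ x ∧ ∀ u, G.Adj v u → col u ≠ x}) ⟨x, hx⟩

lemma freeColor_le (G : SimpleGraph (Fin n)) (col : Fin n → ℕ) (v : Fin n) :
    freeColor G col v ≤ (G.neighborSet v).ncard + 1 := by
  obtain ⟨x, hx, hle⟩ := exists_freeColor G col v
  exact (Nat.sInf_le (s := {x | 1 ≤ x ∧ ∀ u, G.Adj v u → col u ≠ x}) hx).trans hle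

lemma recolor_of_consistent (h : StarConsistent G col v) : recolor G p col v = col v := by
  simp [recolor, h]

lemma recolor_of_active (h0 : col v = 0) (h : ∀ u, G.Adj v u → col u = 0 → p u ≤ p v) :
    recolor G p col v = freeColor G col v := by
  have : ¬ StarConsistent G col v := fun hc => by have := hc.1; omega
  rw [recolor, if_neg this, if_pos ⟨h0, h⟩]

lemma recolor_eq_zero (h : ¬ StarConsistent G col v)
    (h' : ¬ (col v = 0 ∧ ∀ u, G.Adj v u → col u = 0 → p u ≤ p v)) : recolor G p col v = 0 := by
  rw [recolor, if_neg h, if_neg h']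

/-- A recolored neighbor keeps its color, loses it, or takes a color that is free around it. -/
lemma recolor_cases (G : SimpleGraph (Fin n)) (p col : Fin n → ℕ) (u : Fin n) :
    recolor G p col u = col u ∨ recolor G p col u = 0 ∨
      (col u = 0 ∧ (∀ w, G.Adj u w → col w = 0 → p w ≤ p u) ∧
        recolor G p col u = freeColor G col u) := by
  by_cases hc : StarConsistent G col u
  · exact .inl (recolor_of_consistent hc)
  · by_cases ha : col u = 0 ∧ ∀ w, G.Adj u w → col w = 0 → p w ≤ p u
    · exact .inr (.inr ⟨ha.1, ha.2, recolor_of_active ha.1 ha.2⟩)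
    · exact .inr (.inl (recolor_eq_zero hc ha))

lemma StarConsistent.recolor (h : StarConsistent G col v) :
    StarConsistent G (recolor G p col) v := by
  have hv : _root_.recolor G p col v = col v := recolor_of_consistent h
  refine ⟨hv ▸ h.1, hv ▸ h.2.1, fun u hu => ?_⟩
  rw [hv]
  have h1 := h.1
  rcases recolor_cases G p col u with hc | hc | ⟨-, -, hc⟩
  · rw [hc]; exact h.2.2 u hu
  · omega
  · rw [hc]; exact ((freeColor_spec G col u).2 v hu.symm).symm

/-- A neighbor that keeps its color is avoided by the free color, one that becomes `0` differs from
a positive color, and none is active simultaneously since ranks are injective. -/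
lemma starConsistent_recolor_of_active (hp : Function.Injective p) (h0 : col v = 0)
    (h : ∀ u, G.Adj v u → col u = 0 → p u ≤ p v) : StarConsistent G (recolor G p col) v := by
  have hv : recolor G p col v = freeColor G col v := recolor_of_active h0 h
  have hf := freeColor_spec G col v
  refine ⟨hv ▸ hf.1, hv ▸ freeColor_le G col v, fun u hu => ?_⟩
  rw [hv]
  rcases recolor_cases G p col u with hc | hc | ⟨hu0, hmax, -⟩
  · rw [hc]; exact hf.2 u hu
  · omega
  · exact absurd (hp (le_antisymm (h u hu hu0) (hmax v hu.symm h0))) hu.ne'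

lemma recolor_consistent_or_eq_zero (hp : Function.Injective p) (v : Fin n) :
    StarConsistent G (recolor G p col) v ∨ recolor G p col v = 0 := by
  by_cases hc : StarConsistent G col v
  · exact .inl hc.recolor
  · by_cases ha : col v = 0 ∧ ∀ w, G.Adj v w → col w = 0 → p w ≤ p v
    · exact .inl (starConsistent_recolor_of_active hp ha.1 ha.2)
    · exact .inr (recolor_eq_zero hc ha)

lemma ncard_neighborSet_lt (G : SimpleGraph (Fin n)) (v : Fin n) : (G.neighborSet v).ncard < n := by
  have h : G.neighborSet v ⊂ Set.univ :=
    (Set.ssubset_univ_iff).2 fun h => G.irrefl (h ▸ Set.mem_univ v : v ∈ G.neighborSet v)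
  simpa using Set.ncard_lt_ncard h (Set.toFinite _)

lemma recolor_le (h : col v ≤ n) : recolor G p col v ≤ n := by
  rcases recolor_cases G p col v with hc | hc | ⟨-, -, hc⟩
  · omega
  · omega
  · have := freeColor_le G col v
    have := ncard_neighborSet_lt G v
    omega

/-! ### The potential -/

open Classical in
/-- The potential of a star: `0` if it is consistent, otherwise `1` or `2` according to whether its
center has color `0`. -/
noncomputable def starPotential (G : SimpleGraph (Fin n)) (col : Fin n → ℕ) (v : Fin n) : ℕ :=
  if StarConsistent G col v then 0 else if col v = 0 then 1 else 2

lemma starPotential_le_two : starPotential G col v ≤ 2 := by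
  unfold starPotential
  split_ifs <;> omega

lemma starPotential_of_consistent (h : StarConsistent G col v) : starPotential G col v = 0 := by
  rw [starPotential, if_pos h]

lemma starPotential_le_one (h : col v = 0) : starPotential G col v ≤ 1 := by
  unfold starPotential
  split_ifs <;> omega

lemma starPotential_pos (h : ¬ StarConsistent G col v) : 0 < starPotential G col v := by
  unfold starPotential
  split_ifs <;> omega

lemma starPotential_eq_two (h : ¬ StarConsistent G col v) (h0 : col v ≠ 0) :
    starPotential G col v = 2 := by
  rw [starPotential, if_neg h, if_neg h0]

lemma starPotential_recolor_le (hp : Function.Injective p) (v : Fin n) :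
    starPotential G (recolor G p col) v ≤ starPotential G col v := by
  by_cases hc : StarConsistent G col v
  · rw [starPotential_of_consistent hc.recolor]; omega
  · have := starPotential_pos hc
    rcases recolor_consistent_or_eq_zero (G := G) (col := col) hp v with h | h
    · rw [starPotential_of_consistent h]; omega
    · have := starPotential_le_one (G := G) h
      omega

/-- An inconsistent star with nonzero center drops from 2 to at most 1. If there is none, some node
of `V` has color `0`, and the one of largest rank is active and becomes consistent. -/
lemma exists_starPotential_recolor_lt (hp : Function.Injective p) {V : Set (Fin n)}
    (hV : ∀ u v, G.Adj u v → u ∈ V) (h : ¬ IsDegPlusOneColoring V G col) :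
    ∃ v ∈ V, starPotential G (recolor G p col) v < starPotential G col v := by
  unfold IsDegPlusOneColoring at h
  push Not at h
  obtain ⟨v, hv, hbad⟩ := h
  by_cases h2 : ∃ u ∈ V, ¬ StarConsistent G col u ∧ col u ≠ 0
  · obtain ⟨u, hu, hbu, hu0⟩ := h2
    refine ⟨u, hu, ?_⟩
    rw [starPotential_eq_two hbu hu0]
    rcases recolor_consistent_or_eq_zero (G := G) (col := col) hp u with h | h
    · rw [starPotential_of_consistent h]; omega
    · have := starPotential_le_one (G := G) h
      omega
  · push Not at h2
    obtain ⟨w, ⟨hw, hw0⟩, hmax⟩ := Set.exists_max_image {u | u ∈ V ∧ col u = 0} p (Set.toFinite _)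
      ⟨v, hv, h2 v hv hbad⟩
    refine ⟨w, hw, ?_⟩
    rw [starPotential_of_consistent (starConsistent_recolor_of_active hp hw0
      fun u hu hu0 => hmax u ⟨hV u w hu.symm, hu0⟩)]
    exact starPotential_pos fun hc => by have := hc.1; omega

open Classical in
/-- The total potential of the stars with centers in `V`. -/
noncomputable def potential (V : Set (Fin n)) (G : SimpleGraph (Fin n)) (col : Fin n → ℕ) : ℕ :=
  ∑ v, if v ∈ V then starPotential G col v else 0

lemma potential_eq_zero {V : Set (Fin n)} (h : IsDegPlusOneColoring V G col) :
    potential V G col = 0 := by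
  unfold potential
  refine Finset.sum_eq_zero fun v _ => ?_
  split_ifs with hv
  · exact starPotential_of_consistent (h v hv)
  · rfl

lemma potential_recolor_lt (hp : Function.Injective p) {V : Set (Fin n)}
    (hV : ∀ u v, G.Adj u v → u ∈ V) (h : ¬ IsDegPlusOneColoring V G col) :
    potential V G (recolor G p col) < potential V G col := by
  obtain ⟨v, hv, hlt⟩ := exists_starPotential_recolor_lt hp hV h
  refine Finset.sum_lt_sum (fun u _ => ?_) ⟨v, Finset.mem_univ v, ?_⟩
  · split_ifs
    · exact starPotential_recolor_le hp u
    · rfl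
  · simpa [hv] using hlt

lemma isDegPlusOneColoring_recolor {V : Set (Fin n)} (h : IsDegPlusOneColoring V G col) :
    IsDegPlusOneColoring V G (recolor G p col) :=
  fun v hv => (h v hv).recolor

end Recolor

/-! ### The algorithm: simulation, message size, fixing of stars -/

open Classical in
/-- The recoloring algorithm: every node sends its color in binary and recolors itself by `recolor`,
with the ranks given by the clock. -/
noncomputable def recoloringAlgorithm (n : ℕ) : DynamicAlgorithm n where
  Memory := Unit
  initMemory _ := ()
  newState _ := ⟨0, ()⟩
  send _ _ _ s _ := s.color.bits
  update v t N s inbox :=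
    ⟨if 1 ≤ s.color ∧ s.color ≤ N.ncard + 1 ∧ ∀ u, inbox u ≠ some s.color.bits then s.color
      else if s.color = 0 ∧ ∀ u, inbox u = some [] → clockRank t u ≤ clockRank t v then
        sInf {x | 1 ≤ x ∧ ∀ u, inbox u ≠ some x.bits}
      else 0, ()⟩

namespace recoloringAlgorithm

variable {n : ℕ} (D : DynamicNetwork n) (c : Fin n → ℕ)

lemma bits_injective : Function.Injective Nat.bits := fun a b h =>
  Nat.digits.injective 2 (by rw [Nat.digits_two_eq_bits, Nat.digits_two_eq_bits, h])

lemma endColor_eq (i : ℕ) :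
    (recoloringAlgorithm n).endColor D c i =
      recolor (D.graph i) (clockRank i) ((recoloringAlgorithm n).startColor D c i) := by
  classical
  funext v
  set s := (recoloringAlgorithm n).start D c i
  have key : ∀ (u : Fin n) (x : ℕ), (if (D.graph i).Adj v u then
      some ((recoloringAlgorithm n).message D i s u v) else none) = some x.bits ↔
      (D.graph i).Adj v u ∧ (s u).color = x := by
    intro u x
    split_ifs with h
    · simp [h, DynamicAlgorithm.message, recoloringAlgorithm, bits_injective.eq_iff]
    · simp [h]
  have key0 := fun u => key u 0
  -- Color `0` is sent as the empty string, which `update` tests for.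
  rw [Nat.zero_bits] at key0
  have hcol : (recoloringAlgorithm n).startColor D c i = fun u => (s u).color := rfl
  rw [hcol]
  change (DynamicAlgorithm.round _ D i s v).color = _
  unfold DynamicAlgorithm.round
  have : ∀ (N : Set (Fin n)) (t : ℕ) (r : NodeState Unit) (inbox : Fin n → Option (List Bool)),
    ((recoloringAlgorithm n).update v t N r inbox).color =
      if 1 ≤ r.color ∧ r.color ≤ N.ncard + 1 ∧ ∀ u, inbox u ≠ some r.color.bits then r.color
      else if r.color = 0 ∧ ∀ u, inbox u = some [] → clockRank t u ≤ clockRank t v then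
        sInf {x | 1 ≤ x ∧ ∀ u, inbox u ≠ some x.bits}
      else 0 := fun _ _ _ _ => rfl
  erw [this]
  simp only [ne_eq, key, key0, clockRank_mod_mul, not_and, and_imp]
  unfold recolor freeColor StarConsistent
  simp only [ne_eq]

lemma startColor_succ_of_mem {i : ℕ} {v : Fin n} (h : v ∈ D.node i) :
    (recoloringAlgorithm n).startColor D c (i + 1) v =
      (recoloringAlgorithm n).endColor D c i v := by
  simp [DynamicAlgorithm.startColor, DynamicAlgorithm.start, DynamicAlgorithm.endColor, h]

lemma startColor_succ_of_notMem {i : ℕ} {v : Fin n} (h : v ∉ D.node i) :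
    (recoloringAlgorithm n).startColor D c (i + 1) v = 0 := by
  simp [DynamicAlgorithm.startColor, DynamicAlgorithm.start, recoloringAlgorithm, h]

variable {c}

lemma startColor_le (hc : IsDegPlusOneColoring (D.node 0) (D.graph 0) c) (i : ℕ) (v : Fin n)
    (hv : v ∈ D.node i) : (recoloringAlgorithm n).startColor D c i v ≤ n := by
  induction i generalizing v with
  | zero =>
    have := (hc v hv).2.1
    have := ncard_neighborSet_lt (D.graph 0) v
    change c v ≤ n
    omega
  | succ i ih =>
    by_cases h : v ∈ D.node i
    · rw [startColor_succ_of_mem D c h, endColor_eq]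
      exact recolor_le (ih v h)
    · rw [startColor_succ_of_notMem D c h]
      omega

theorem messagesAtMost (hc : IsDegPlusOneColoring (D.node 0) (D.graph 0) c) :
    (recoloringAlgorithm n).MessagesAtMost D c (2 * Nat.log 2 n) := by
  intro i v u huv
  have hle := startColor_le D hc i v (D.mem_node_of_adj i v u huv)
  -- An edge forces `n ≥ 2`, so the `log n + 1` bits of a color fit into `2 * log n`.
  have hn : 2 ≤ n := by
    have := v.isLt
    have := u.isLt
    have : v.val ≠ u.val := fun h => huv.ne (Fin.ext h)
    omega
  have hlog : 1 ≤ Nat.log 2 n := Nat.log_pos (by norm_num) hn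
  change ((recoloringAlgorithm n).startColor D c i v).bits.length ≤ _
  rw [Nat.size_eq_bits_len]
  refine (Nat.size_le.2 (hle.trans_lt (Nat.lt_pow_succ_log_self (by norm_num) n))).trans ?_
  omega

theorem fixesStars : (recoloringAlgorithm n).FixesStars D c := by
  intro i v hv
  have hn : 0 < n := v.pos
  obtain ⟨j, hij, hj⟩ : ∃ j ≥ i, (j + 1) % n = v.val := by
    -- Round `j` leaves `v` consistent or with color `0`; in the latter case `v` has top rank in
    -- round `j + 1`.
    refine ⟨n * (i + 1) + v - 1, ?_, ?_⟩
    · have := Nat.le_mul_of_pos_left (i + 1) hn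
      omega
    · have := Nat.le_mul_of_pos_left (i + 1) hn
      rw [Nat.sub_add_cancel (by omega), Nat.mul_add_mod, Nat.mod_eq_of_lt v.isLt]
  have hvj : v ∈ D.node j := monotone_nat_of_le_succ D.node_subset_succ hij hv
  have hor := recolor_consistent_or_eq_zero (G := D.graph j)
    (col := (recoloringAlgorithm n).startColor D c j) (clockRank_injective j) v
  rw [← endColor_eq] at hor
  rcases hor with h | h
  · exact ⟨j, hij, .inl h⟩
  · refine ⟨j + 1, by omega, .inl ?_⟩
    rw [endColor_eq]
    rw [← startColor_succ_of_mem D c hvj] at h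
    refine starConsistent_recolor_of_active (clockRank_injective _) h fun u _ _ => ?_
    refine (clockRank_le _ u).trans_eq ?_
    rw [clockRank, if_pos hj.symm]

/-! ### Amortization under topology changes -/

/-- If no edge at `v` changes, then the star of `v` stays consistent. -/
lemma starConsistent_succ {i : ℕ} {v : Fin n} (hv : v ∈ D.node i)
    (he : ∀ e ∈ D.changedEdges i, v ∉ e)
    (h : StarConsistent (D.graph i) ((recoloringAlgorithm n).endColor D c i) v) :
    StarConsistent (D.graph (i + 1)) ((recoloringAlgorithm n).startColor D c (i + 1)) v := by
  have hadj : ∀ u ∈ D.node i, ((D.graph i).Adj v u ↔ (D.graph (i + 1)).Adj v u) := by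
    intro u hu
    have := he s(v, u)
    simp only [DynamicNetwork.changedEdges, Set.mem_ofPred_eq, SimpleGraph.mem_edgeSet,
      Sym2.mem_iff, forall_eq_or_imp, forall_eq, true_or, not_true_eq_false, imp_false] at this
    tauto
  -- Only inserted nodes can be new neighbors, so the degree does not drop; they enter with color
  -- `0`, so they cause no conflict.
  have hsub : (D.graph i).neighborSet v ⊆ (D.graph (i + 1)).neighborSet v := fun u hu =>
    (hadj u (D.mem_node_of_adj i u v (SimpleGraph.Adj.symm hu))).1 hu
  have hcard := Set.ncard_le_ncard hsub (Set.toFinite _)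
  have h1 := h.1
  have h2 := h.2.1
  rw [StarConsistent, startColor_succ_of_mem D c hv]
  refine ⟨h1, by omega, fun u hu => ?_⟩
  by_cases hui : u ∈ D.node i
  · rw [startColor_succ_of_mem D c hui]
    exact h.2.2 u ((hadj u hui).2 hu)
  · rw [startColor_succ_of_notMem D c hui]
    omega

open Classical in
lemma starPotential_succ_le (i : ℕ) (v : Fin n) :
    starPotential (D.graph (i + 1)) ((recoloringAlgorithm n).startColor D c (i + 1)) v ≤
      (if v ∈ D.node i then
        starPotential (D.graph i) ((recoloringAlgorithm n).endColor D c i) v else 0) +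
      (if v ∈ D.node i then 0 else 1) +
      if ∃ e ∈ D.changedEdges i, v ∈ e then 2 else 0 := by
  by_cases hv : v ∈ D.node i
  · by_cases he : ∃ e ∈ D.changedEdges i, v ∈ e
    · have := starPotential_le_two (G := D.graph (i + 1)) (v := v)
        (col := (recoloringAlgorithm n).startColor D c (i + 1))
      simp only [he, if_true]
      omega
    · simp only [hv, he, if_true, if_false, add_zero]
      push Not at he
      by_cases h : StarConsistent (D.graph i) ((recoloringAlgorithm n).endColor D c i) v
      · rw [starPotential_of_consistent (starConsistent_succ D hv he h)]
        omega
      · by_cases h0 : (recoloringAlgorithm n).endColor D c i v = 0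
        · have := starPotential_pos h
          have := starPotential_le_one (G := D.graph (i + 1))
            ((startColor_succ_of_mem D c hv).trans h0)
          omega
        · rw [starPotential_eq_two h h0]
          exact starPotential_le_two
  · have := starPotential_le_one (G := D.graph (i + 1)) (startColor_succ_of_notMem D c hv)
    simp only [hv, if_false]
    omega

lemma ncard_endpoints_le (S : Set (Sym2 (Fin n))) :
    {v | ∃ e ∈ S, v ∈ e}.ncard ≤ 2 * S.ncard := by
  classical
  have hS := Set.toFinite S
  have : {v | ∃ e ∈ S, v ∈ e} = (hS.toFinset.biUnion Sym2.toFinset : Finset (Fin n)) := by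
    ext v
    simp
  rw [this, Set.ncard_coe_finset, Set.ncard_eq_toFinset_card S hS, mul_comm]
  refine Finset.card_biUnion_le_card_mul _ _ _ fun e _ => ?_
  by_cases he : e.IsDiag
  · rw [Sym2.card_toFinset_of_isDiag e he]; omega
  · rw [Sym2.card_toFinset_of_not_isDiag e he]

/-- An edge change affects two endpoints, each by at most 2, hence the 4. An insertion costs only 1,
for the new star itself. -/
lemma potential_succ_le (i : ℕ) :
    potential (D.node (i + 1)) (D.graph (i + 1))
        ((recoloringAlgorithm n).startColor D c (i + 1)) ≤
      potential (D.node i) (D.graph i) ((recoloringAlgorithm n).endColor D c i) +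
        4 * ((D.insertedNodes i).ncard + (D.changedEdges i).ncard) := by
  classical
  have hpt : ∀ v, (if v ∈ D.node (i + 1) then starPotential (D.graph (i + 1))
        ((recoloringAlgorithm n).startColor D c (i + 1)) v else 0) ≤
      (if v ∈ D.node i then
        starPotential (D.graph i) ((recoloringAlgorithm n).endColor D c i) v else 0) +
      (if v ∈ D.insertedNodes i then 1 else 0) +
      if v ∈ {v | ∃ e ∈ D.changedEdges i, v ∈ e} then 2 else 0 := by
    intro v
    have := starPotential_succ_le (c := c) D i v
    by_cases h' : v ∈ D.node (i + 1)
    · simp only [DynamicNetwork.insertedNodes, Set.mem_sdiff, h', true_and, if_true, ite_not,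
        Set.mem_ofPred_eq]
      exact this
    · simp [h']
  have hsum := Finset.sum_le_sum fun v (_ : v ∈ Finset.univ) => hpt v
  have hcard : ∀ (S : Set (Fin n)) [DecidablePred (· ∈ S)] (m : ℕ), ∑ v, (if v ∈ S then m else 0) = S.ncard * m := by
    intro S _ m
    rw [← Finset.sum_filter, Finset.sum_const, smul_eq_mul, Set.ncard_eq_toFinset_card']
    congr 2
    ext v
    simp
  rw [Finset.sum_add_distrib, Finset.sum_add_distrib, hcard, hcard] at hsum
  have := ncard_endpoints_le (D.changedEdges i)
  unfold potential
  omega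

lemma not_coloring_of_incorrectRound {i : ℕ}
    (h : (recoloringAlgorithm n).IncorrectRound D c i) :
    ¬ IsDegPlusOneColoring (D.node i) (D.graph i) ((recoloringAlgorithm n).startColor D c i) := by
  intro hcol
  rcases h with h | h
  · exact h hcol
  · rw [endColor_eq] at h
    exact h (isDegPlusOneColoring_recolor hcol)

open Classical in
lemma potential_endColor_add_le (i : ℕ) :
    potential (D.node i) (D.graph i) ((recoloringAlgorithm n).endColor D c i) +
      (if (recoloringAlgorithm n).IncorrectRound D c i then 1 else 0) ≤
    potential (D.node i) (D.graph i) ((recoloringAlgorithm n).startColor D c i) := by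
  by_cases h : IsDegPlusOneColoring (D.node i) (D.graph i)
      ((recoloringAlgorithm n).startColor D c i)
  · rw [if_neg fun hi => not_coloring_of_incorrectRound D hi h, endColor_eq,
      potential_eq_zero (isDegPlusOneColoring_recolor h)]
    omega
  · have := potential_recolor_lt (clockRank_injective i) (D.mem_node_of_adj i) h
    rw [endColor_eq]
    split_ifs <;> omega

open Classical in
lemma sum_incorrect_add_potential_le (hc : IsDegPlusOneColoring (D.node 0) (D.graph 0) c)
    (i : ℕ) :
    (∑ t ∈ Finset.range i, if (recoloringAlgorithm n).IncorrectRound D c t then 1 else 0) +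
      potential (D.node i) (D.graph i) ((recoloringAlgorithm n).startColor D c i) ≤
    4 * D.changes i := by
  induction i with
  | zero =>
    have : potential (D.node 0) (D.graph 0) ((recoloringAlgorithm n).startColor D c 0) = 0 :=
      potential_eq_zero hc
    simp [this]
  | succ i ih =>
    have h1 := potential_succ_le (c := c) D i
    have h2 := potential_endColor_add_le (c := c) D i
    unfold DynamicNetwork.changes at ih ⊢
    rw [Finset.sum_range_succ, Finset.sum_range_succ]
    omega

theorem amortizedRoundsAtMost (hc : IsDegPlusOneColoring (D.node 0) (D.graph 0) c) :
    (recoloringAlgorithm n).AmortizedRoundsAtMost D c 4 := by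
  classical
  intro i
  have hset : {t : ℕ | t ≤ i ∧ (recoloringAlgorithm n).IncorrectRound D c t} =
      ((Finset.range (i + 1)).filter fun t =>
        (recoloringAlgorithm n).IncorrectRound D c t : Finset ℕ) := by
    ext t
    simp
  have h1 := sum_incorrect_add_potential_le D hc i
  -- The invariant counts rounds before `i`; the drop within round `i` pays for that round.
  have h2 := potential_endColor_add_le (c := c) D i
  rw [DynamicAlgorithm.incorrect, hset, Set.ncard_coe_finset, Finset.card_filter,
    Finset.sum_range_succ]
  omega

end recoloringAlgorithm

theorem mainTheorem9 :
    ∃ (A : (n : ℕ) → DynamicAlgorithm n) (b k : ℕ),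
      ∀ (n : ℕ) (D : DynamicNetwork n) (c : Fin n → ℕ),
        IsDegPlusOneColoring (D.node 0) (D.graph 0) c →
          (A n).MessagesAtMost D c (b * Nat.log 2 n) ∧
          (A n).FixesStars D c ∧
          (A n).AmortizedRoundsAtMost D c k :=
  ⟨recoloringAlgorithm, 2, 4, fun _ D _ hc =>
    ⟨recoloringAlgorithm.messagesAtMost D hc, recoloringAlgorithm.fixesStars D,
      recoloringAlgorithm.amortizedRoundsAtMost D hc⟩⟩
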